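/- Let $X$ be a Tychonoff ($T_1$ and completely regular) space with co-diagonal $\Delta^c_X=(X\times X)\setminus\{(x,x):x\in X\}$, regarded as a subspace of $X\times X$. Suppose that $\Delta^c_X$ is discretely $\sigma$-compact, that is, for every $D\subseteq\Delta^c_X$ whose subspace topology is discrete, the closure of $D$ in $\Delta^c_X$ is $\sigma$-compact (a union of countably many compact sets). (a) If $X$ is pseudocompact, that is, every continuous function $X\to\mathbb{R}$ is bounded, then $X$ is compact and metrizable. (b) If $X$ is a Lindelöf $\Sigma$-space, that is, there are a cover $\mathcal{C}$ of $X$ by compact sets and a countable family $\mathcal{F}$ of subsets of $X$ such that for every $C\in\mathcal{C}$ and every open $U\supseteq C$ there is $F\in\mathcal{F}$ with $C\subseteq F\subseteq U$, then $X$ is cosmic, that is, there is a countable family $\mathcal{N}$ of subsets of $X$ such that every open subset of $X$ is a union of members of $\mathcal{N}$. -/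

import Mathlib

/-- A topological space `Y` is discretely σ-compact: the closure in `Y` of every discrete subset
of `Y` (a subset whose subspace topology is discrete) is σ-compact. -/
def DiscretelySigmaCompact (Y : Type*) [TopologicalSpace Y] : Prop :=
  ∀ D : Set Y, IsDiscrete D → IsSigmaCompact (closure D)

/-- The co-diagonal `(X × X) \ Δ_X` of `X`. As a type, it carries the subspace topology
inherited from the product `X × X`. -/
def coDiagonal (X : Type*) : Set (X × X) := (Set.diagonal X)ᶜ

/-- Every continuous real-valued function on `X` is bounded. -/
def IsPseudocompact (X : Type*) [TopologicalSpace X] : Prop :=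
  ∀ f : X → ℝ, Continuous f → Bornology.IsBounded (Set.range f)

/-- The family `F` of subsets of `X` is a network modulo the family `C`: whenever a member `K`
of `C` is contained in an open set `U`, there is `A ∈ F` with `K ⊆ A ⊆ U`. -/
def IsNetworkModulo {X : Type*} [TopologicalSpace X] (F C : Set (Set X)) : Prop :=
  ∀ K ∈ C, ∀ U : Set X, IsOpen U → K ⊆ U → ∃ A ∈ F, K ⊆ A ∧ A ⊆ U

/-- The Lindelöf Σ-property (of a Tychonoff space): some countable family of subsets is a network
modulo some cover of the space by compact sets. -/
def IsLindelofSigma (X : Type*) [TopologicalSpace X] : Prop :=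
  ∃ F C : Set (Set X), F.Countable ∧ (∀ K ∈ C, IsCompact K) ∧ ⋃₀ C = Set.univ ∧
    IsNetworkModulo F C

/-- The family `N` of subsets of `X` is a network: every open set is a union of members of `N`. -/
def IsNetwork {X : Type*} [TopologicalSpace X] (N : Set (Set X)) : Prop :=
  ∀ U : Set X, IsOpen U → ∃ N' ⊆ N, U = ⋃₀ N'

/-- A space is cosmic if it has a countable network. -/
def IsCosmic (X : Type*) [TopologicalSpace X] : Prop :=
  ∃ N : Set (Set X), N.Countable ∧ IsNetwork N

/-! Both parts follow from a continuous injection of X into ℝ^ℕ. It exists as soon as the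
co-diagonal is Lindelöf: the open sets {g(x) ≠ g(y)}, with g continuous, cover it, and a countable
subcover gives the coordinates.

For Lindelöfness, let E be a discrete subset of a compact set. The off-diagonal part of E × E is
discrete, so its closure is σ-compact, countably many functions separate the points of cl E, and the
compact set cl E is second countable; thus E is countable. A failure of countable tightness in a
compact set would yield an uncountable discrete subset of it, so compact sets are countably tight,
in X × X too. If the co-diagonal were not Lindelöf, it would contain a free sequence D of length ω₁.
By tightness the union of the closures of countable subsets of D is σ-compact, hence Lindelöf, and
this makes D countable. -/

open Set Topology

/-! ### Free sequences of length ω₁ -/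

/-- If a transfinite sequence is such that no term lies in the closure of its predecessors, and
each term has a neighbourhood containing no later term, then it enumerates a discrete set. -/
theorem isDiscrete_image_of_left_right_separated {ι Y : Type*} [LinearOrder ι]
    [TopologicalSpace Y] (p : ι → Y) (I : Set ι) (U : ι → Set Y) (hU : ∀ i, IsOpen (U i))
    (hpU : ∀ i, p i ∈ U i) (hright : ∀ i j, i < j → p j ∉ U i)
    (hleft : ∀ i ∈ I, p i ∉ closure (p '' Iio i)) : IsDiscrete (p '' I) := by
  rw [isDiscrete_iff_forall_mem_exists_isOpen]
  rintro _ ⟨i, hi, rfl⟩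
  refine ⟨U i ∩ (closure (p '' Iio i))ᶜ, (hU i).inter isClosed_closure.isOpen_compl, ?_⟩
  ext y
  simp only [mem_inter_iff, mem_compl_iff, mem_singleton_iff]
  constructor
  · rintro ⟨⟨h1, h2⟩, j, hj, rfl⟩
    rcases lt_trichotomy j i with h | h | h
    · exact absurd (subset_closure (show p j ∈ p '' Iio i from ⟨j, h, rfl⟩)) h2
    · rw [h]
    · exact absurd h1 (hright i j h)
  · rintro rfl
    exact ⟨⟨hpU i, hleft i hi⟩, mem_image_of_mem p hi⟩

/-- The order is ω₁: countable initial segments ensure that each stage of a recursion has used up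
only countably many members of a cover. -/
theorem exists_uncountable_wellOrder : ∃ (ι : Type) (_ : LinearOrder ι) (_ : WellFoundedLT ι),
    Uncountable ι ∧ ∀ i : ι, (Iio i).Countable := by
  refine ⟨(Cardinal.aleph 1).ord.ToType, inferInstance, inferInstance, ?_, ?_⟩
  · rw [← Cardinal.aleph0_lt_mk_iff, Cardinal.mk_ord_toType]
    exact Cardinal.aleph0_lt_aleph_one
  · intro i
    have := Cardinal.mk_Iio_lt i (by simp)
    rwa [Cardinal.mk_ord_toType, Cardinal.lt_aleph_one_iff, Cardinal.le_aleph0_iff_set_countable] at this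

/-- In a space with an open cover without countable subcovers, in which the closures of countable
discrete sets are countably covered, there is a long free sequence. -/
theorem exists_uncountable_discrete {Y : Type*} [TopologicalSpace Y] (𝒰 : Set (Set Y))
    (ho : ∀ U ∈ 𝒰, IsOpen U) (hc : ⋃₀ 𝒰 = univ)
    (hn : ∀ 𝒱 ⊆ 𝒰, 𝒱.Countable → ⋃₀ 𝒱 ≠ univ)
    (hd : ∀ E : Set Y, E.Countable → IsDiscrete E →
      ∃ 𝒱 ⊆ 𝒰, 𝒱.Countable ∧ closure E ⊆ ⋃₀ 𝒱) :
    ∃ D : Set Y, IsDiscrete D ∧ ¬ D.Countable ∧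
      ∀ B ⊆ D, B.Countable → ∃ W, IsOpen W ∧ closure B ⊆ W ∧ (W ∩ D).Countable := by
  obtain ⟨ι, _, _, hι, hcount⟩ := exists_uncountable_wellOrder
  have hU : ∀ y : Y, ∃ U ∈ 𝒰, y ∈ U := fun y => by
    have : y ∈ ⋃₀ 𝒰 := hc ▸ mem_univ y
    exact this
  choose U hU𝒰 hyU using hU
  have hΦ : ∀ E : Set Y, ∃ 𝒱 ⊆ 𝒰, 𝒱.Countable ∧
      (E.Countable → IsDiscrete E → closure E ⊆ ⋃₀ 𝒱) := by
    intro E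
    by_cases h : E.Countable ∧ IsDiscrete E
    · obtain ⟨𝒱, h1, h2, h3⟩ := hd E h.1 h.2
      exact ⟨𝒱, h1, h2, fun _ _ => h3⟩
    · exact ⟨∅, empty_subset _, countable_empty, fun h1 h2 => absurd ⟨h1, h2⟩ h⟩
  choose Φ hΦ𝒰 hΦc hΦ using hΦ
  have hpt : ∀ 𝒱 : Set (Set Y), ∃ y, 𝒱 ⊆ 𝒰 → 𝒱.Countable → y ∉ ⋃₀ 𝒱 := by
    intro 𝒱
    by_cases h : 𝒱 ⊆ 𝒰 ∧ 𝒱.Countable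
    · obtain ⟨y, hy⟩ := (ne_univ_iff_exists_notMem _).1 (hn 𝒱 h.1 h.2)
      exact ⟨y, fun _ _ => hy⟩
    · obtain ⟨y, hy⟩ := (ne_univ_iff_exists_notMem _).1 (hn ∅ (empty_subset _) countable_empty)
      exact ⟨y, fun h1 h2 => absurd ⟨h1, h2⟩ h⟩
  choose pt hpt using hpt
  -- The new point avoids the chosen neighbourhoods of earlier points and the covers of the closures
  -- of all initial segments; `j = i` is included so that it avoids the closure of its own
  -- predecessors.
  let step : ∀ i : ι, (∀ j, j < i → Y) → Y := fun i ih =>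
    pt ({V | ∃ j, ∃ h : j < i, V = U (ih j h)} ∪
      ⋃ j ∈ Iic i, Φ {y | ∃ k, ∃ h : k < i, k < j ∧ y = ih k h})
  let p : ι → Y := (wellFounded_lt (α := ι)).fix step
  have hp : ∀ i, p i = pt (U ∘ p '' Iio i ∪ ⋃ j ∈ Iic i, Φ (p '' Iio j)) := by
    intro i
    have h0 : p i = step i fun j _ => p j := WellFounded.fix_eq _ _ _
    rw [h0]
    simp only [step]
    congr 2
    · ext V
      simp [eq_comm]
    · refine iUnion₂_congr fun j hj => ?_
      congr 1
      ext y
      constructor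
      · rintro ⟨k, _, hk, rfl⟩
        exact ⟨k, hk, rfl⟩
      · rintro ⟨k, hk, rfl⟩
        exact ⟨k, lt_of_lt_of_le hk hj, hk, rfl⟩
  have hIic : ∀ i : ι, (Iic i).Countable := fun i => by
    rw [← Iio_insert]
    exact (hcount i).insert i
  have havoid : ∀ i, p i ∉ ⋃₀ (U ∘ p '' Iio i ∪ ⋃ j ∈ Iic i, Φ (p '' Iio j)) := by
    intro i
    rw [hp i]
    refine hpt _ (union_subset ?_ (iUnion₂_subset fun _ _ => hΦ𝒰 _)) ?_
    · rintro _ ⟨j, _, rfl⟩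
      exact hU𝒰 _
    · exact ((hcount i).image _).union ((hIic i).biUnion fun _ _ => hΦc _)
  have hright : ∀ i j, i < j → p j ∉ U (p i) := fun i j hij h =>
    havoid j ⟨_, Or.inl (mem_image_of_mem _ hij), h⟩
  have hΦavoid : ∀ i j, i ≤ j → p j ∉ ⋃₀ Φ (p '' Iio i) := by
    rintro i j hij ⟨V, hV, h⟩
    exact havoid j ⟨V, Or.inr (mem_biUnion hij hV), h⟩
  have hseg : ∀ I : Set ι, (∀ i ∈ I, p i ∉ closure (p '' Iio i)) → IsDiscrete (p '' I) :=
    fun I h => isDiscrete_image_of_left_right_separated p I (fun i => U (p i))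
      (fun i => ho _ (hU𝒰 _)) (fun i => hyU _) hright h
  have hdisc : ∀ i, IsDiscrete (p '' Iio i) := by
    intro i
    induction i using WellFoundedLT.induction with
    | ind i ih =>
      exact hseg _ fun j hj h =>
        hΦavoid j j le_rfl (hΦ _ ((hcount j).image p) (ih j hj) h)
  have hcl : ∀ i, closure (p '' Iio i) ⊆ ⋃₀ Φ (p '' Iio i) := fun i =>
    hΦ _ ((hcount i).image p) (hdisc i)
  have hinj : Function.Injective p := by
    intro i j hij
    rcases lt_trichotomy i j with h | h | h
    · exact absurd (hij ▸ hyU (p i)) (hright i j h)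
    · exact h
    · exact absurd (hij ▸ hyU (p i)) (hij ▸ hright j i h)
  refine ⟨range p, image_univ (f := p) ▸ hseg univ fun i _ h => hΦavoid i i le_rfl (hcl i h),
    ?_, ?_⟩
  · intro h
    have hpre : (p ⁻¹' range p).Countable := h.preimage_of_injOn hinj.injOn
    rw [preimage_range, countable_univ_iff] at hpre
    exact not_countable (α := ι) hpre
  · intro B hB hBc
    have hJc : (p ⁻¹' B).Countable := hBc.preimage_of_injOn hinj.injOn
    obtain ⟨i, hi⟩ : ∃ i, ∀ j ∈ p ⁻¹' B, j < i := by
      by_contra! hcon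
      refine not_countable (α := ι) (countable_univ_iff.1
        ((hJc.biUnion fun j _ => hIic j).mono fun i _ => ?_))
      obtain ⟨j, hj, hij⟩ := hcon i
      exact mem_biUnion hj hij
    refine ⟨⋃₀ Φ (p '' Iio i), isOpen_sUnion fun V hV => ho V (hΦ𝒰 _ hV), ?_, ?_⟩
    · refine (closure_mono fun y hy => ?_).trans (hcl i)
      obtain ⟨j, rfl⟩ := hB hy
      exact ⟨j, hi j hy, rfl⟩
    · refine ((hcount i).image p).mono ?_
      rintro _ ⟨hV, j, rfl⟩
      by_contra hj
      exact hΦavoid i j (not_lt.1 fun h => hj ⟨j, h, rfl⟩) hV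

theorem exists_countable_image_eq {α β : Type*} {f : α → β} {s : Set α} {t : Set β}
    (hts : t ⊆ f '' s) (ht : t.Countable) : ∃ u ⊆ s, u.Countable ∧ f '' u = t := by
  choose g hgs hg using fun y : t => hts y.2
  have : Countable t := ht
  refine ⟨range g, range_subset_iff.2 hgs, countable_range g, ?_⟩
  rw [← range_comp, show f ∘ g = Subtype.val from funext hg, Subtype.range_coe]

/-! ### Separating pairs by countably many functions -/

/-- Countably many continuous functions separate the pairs in a Lindelöf set off the diagonal. -/
theorem IsLindelof.exists_continuous_separating {X : Type*} [TopologicalSpace X] [T35Space X]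
    {L : Set (X × X)} (hL : IsLindelof L) (hne : ∀ z ∈ L, z.1 ≠ z.2) :
    ∃ f : X → ℕ → ℝ, Continuous f ∧ ∀ z ∈ L, f z.1 ≠ f z.2 := by
  obtain ⟨r, hr, hcov⟩ := hL.elim_countable_subcover
    (fun g : C(X, ℝ) => {z : X × X | g z.1 ≠ g z.2})
    (fun g => isOpen_ne_fun (by fun_prop) (by fun_prop)) (by
      intro z hz
      obtain ⟨g, hg, h0, h1⟩ := CompletelyRegularSpace.completely_regular z.1 {z.2}
        isClosed_singleton (hne z hz)
      refine mem_iUnion.2 ⟨⟨fun x => (g x : ℝ), by fun_prop⟩, ?_⟩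
      have h2 : g z.2 = 1 := h1 rfl
      simp [h0, h2])
  obtain ⟨g, hg⟩ := (hr.insert 0).exists_eq_range (insert_nonempty _ _)
  refine ⟨fun x n => g n x, by fun_prop, fun z hz heq => ?_⟩
  obtain ⟨h, hhr, hz'⟩ := mem_iUnion₂.1 (hcov hz)
  obtain ⟨n, rfl⟩ : h ∈ range g := hg ▸ mem_insert_of_mem _ hhr
  exact hz' (congrFun heq n)

/-- A discrete subset of a compact subset of a space with discretely σ-compact co-diagonal is
countable. -/
theorem DiscretelySigmaCompact.countable_of_isDiscrete {X : Type*} [TopologicalSpace X]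
    [T35Space X] (hX : DiscretelySigmaCompact (coDiagonal X)) {E K : Set X} (hE : IsDiscrete E)
    (hK : IsCompact K) (hEK : E ⊆ K) : E.Countable := by
  let D : Set (coDiagonal X) := Subtype.val ⁻¹' (E ×ˢ E)
  have hD : IsDiscrete D := by
    rw [isDiscrete_iff_forall_mem_exists_isOpen] at hE ⊢
    rintro ⟨⟨x, y⟩, hxy⟩ ⟨hx, hy⟩
    obtain ⟨u, hu, hux⟩ := hE x hx
    obtain ⟨v, hv, hvy⟩ := hE y hy
    refine ⟨Subtype.val ⁻¹' (u ×ˢ v), (hu.prod hv).preimage continuous_subtype_val, ?_⟩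
    have h : ∀ a b, (a ∈ u ∩ E ∧ b ∈ v ∩ E) ↔ a = x ∧ b = y := by simp [hux, hvy]
    ext ⟨⟨a, b⟩, hab⟩
    simp only [D, mem_inter_iff, mem_preimage, mem_prod, mem_singleton_iff, Subtype.mk.injEq,
      Prod.mk.injEq]
    rw [← h]
    simp only [mem_inter_iff]
    tauto
  obtain ⟨f, hf, hsep⟩ := ((hX D hD).isLindelof.image continuous_subtype_val
    ).exists_continuous_separating (X := X) (by
      rintro _ ⟨z, _, rfl⟩
      exact z.2)
  have hclK : IsCompact (closure E) :=
    hK.of_isClosed_subset isClosed_closure (closure_minimal hEK hK.isClosed)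
  have hinj : InjOn f (closure E) := by
    intro x hx y hy hxy
    by_contra hne
    refine hsep (x, y) ⟨⟨(x, y), hne⟩, ?_, rfl⟩ hxy
    -- The co-diagonal is open, so the closure of `D` in it is the trace of cl E × cl E.
    have hop : IsOpenEmbedding (Subtype.val : coDiagonal X → X × X) :=
      isClosed_diagonal.isOpen_compl.isOpenEmbedding_subtypeVal
    rw [← hop.isOpenMap.preimage_closure_eq_closure_preimage hop.continuous]
    simp only [mem_preimage, closure_prod_eq]
    exact ⟨hx, hy⟩
  have : CompactSpace (closure E) := isCompact_iff_compactSpace.1 hclK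
  have hemb : IsClosedEmbedding ((closure E).domRestrict f) :=
    (hf.comp continuous_subtype_val).isClosedEmbedding hinj.injective
  have : SecondCountableTopology (closure E) := hemb.isInducing.secondCountableTopology
  have hpre : IsDiscrete (Subtype.val ⁻¹' E : Set (closure E)) :=
    hE.preimage continuous_subtype_val.continuousOn Subtype.val_injective
  have hc := (HereditarilyLindelofSpace.isLindelof _).countable_of_isDiscrete hpre
  have := hc.image Subtype.val
  rwa [Subtype.image_preimage_coe, inter_eq_right.2 subset_closure] at this

/-! ### Countable tightness of compact sets -/

/-- A set is ω-closed if it contains the closures of its countable subsets. -/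
def IsOmegaClosed {X : Type*} [TopologicalSpace X] (A : Set X) : Prop :=
  ∀ B ⊆ A, B.Countable → closure B ⊆ A

/-- All compact subsets are countably tight. -/
def CompactlyCountablyTight (X : Type*) [TopologicalSpace X] : Prop :=
  ∀ A K : Set X, IsCompact K → A ⊆ K → IsOmegaClosed A → IsClosed A

theorem IsOmegaClosed.inter {X : Type*} [TopologicalSpace X] {A F : Set X}
    (hA : IsOmegaClosed A) (hF : IsClosed F) : IsOmegaClosed (A ∩ F) := fun B hB hBc =>
  subset_inter (hA B (hB.trans inter_subset_left) hBc)
    (closure_minimal (hB.trans inter_subset_right) hF)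

/-- The countable tightness of compact sets passes to the square. -/
theorem CompactlyCountablyTight.prod {X : Type*} [TopologicalSpace X] [T3Space X]
    (hX : CompactlyCountablyTight X) : CompactlyCountablyTight (X × X) := by
  intro A M hM hAM hA
  refine isClosed_of_closure_subset ?_
  rintro ⟨a, b⟩ hab
  by_contra hnot
  have hslice : IsClosed {y | (a, y) ∈ A} := by
    refine hX _ (Prod.snd '' M) (hM.image continuous_snd) (fun y hy => ⟨_, hAM hy, rfl⟩) ?_
    intro B hB hBc y hy
    refine hA (Prod.mk a '' B) (image_subset_iff.2 hB) (hBc.image _) ?_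
    exact image_closure_subset_closure_image (by fun_prop) (mem_image_of_mem _ hy)
  obtain ⟨N, hN, hNc, hNA⟩ := exists_mem_nhds_isClosed_subset (hslice.isOpen_compl.mem_nhds hnot)
  -- Over `N` the set `A` has no point with first coordinate `a`, yet its projection will be closed
  -- and have `a` in its closure.
  have hA' : IsOmegaClosed (A ∩ Prod.snd ⁻¹' N) := hA.inter (hNc.preimage continuous_snd)
  have hproj : IsClosed (Prod.fst '' (A ∩ Prod.snd ⁻¹' N)) := by
    refine hX _ (Prod.fst '' M) (hM.image continuous_fst)
      (image_mono (inter_subset_left.trans hAM)) ?_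
    intro B hB hBc
    obtain ⟨B', hB', hB'c, rfl⟩ := exists_countable_image_eq hB hBc
    have hcl := hA' B' hB' hB'c
    have hcomp : IsCompact (closure B') := hM.of_isClosed_subset isClosed_closure
      (hcl.trans (inter_subset_left.trans hAM))
    refine (closure_minimal (image_mono subset_closure)
      (hcomp.image continuous_fst).isClosed).trans (image_mono hcl)
  have ha : a ∈ closure (Prod.fst '' (A ∩ Prod.snd ⁻¹' N)) := by
    have : (a, b) ∈ closure (A ∩ Prod.snd ⁻¹' N) := by
      rw [mem_closure_iff_nhds] at hab ⊢
      intro t ht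
      obtain ⟨z, ⟨hz1, hz2⟩, hz3⟩ := hab (t ∩ Prod.snd ⁻¹' N)
        (Filter.inter_mem ht (continuous_snd.continuousAt hN))
      exact ⟨z, hz1, hz3, hz2⟩
    exact image_closure_subset_closure_image continuous_fst (mem_image_of_mem _ this)
  rw [hproj.closure_eq] at ha
  obtain ⟨⟨_, c⟩, ⟨hcA, hcN⟩, rfl⟩ := ha
  exact hNA hcN hcA

/-- If the discrete subsets of compact sets are countable, then compact sets are countably
tight. -/
theorem compactlyCountablyTight_of_countable_of_isDiscrete {X : Type*} [TopologicalSpace X]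
    [T3Space X] (hX : ∀ E K : Set X, IsDiscrete E → IsCompact K → E ⊆ K → E.Countable) :
    CompactlyCountablyTight X := by
  intro A K hK hAK hA
  refine isClosed_of_closure_subset fun p hp => ?_
  by_contra hpA
  have hBcomp : ∀ B ⊆ A, B.Countable → IsCompact (closure B) := fun B hB hBc =>
    hK.of_isClosed_subset isClosed_closure ((hA B hB hBc).trans hAK)
  -- No countable subfamily covers `A`: a sequence entering the neighbourhoods one after another has
  -- a cluster point in `A` lying in all of them.
  let 𝒰 : Set (Set A) := {U | ∃ N ∈ 𝓝 p, IsClosed N ∧ U = Subtype.val ⁻¹' Nᶜ}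
  suffices h : ∃ D : Set A, IsDiscrete D ∧ ¬ D.Countable by
    obtain ⟨D, hD, hDc⟩ := h
    exact hDc (countable_of_injective_of_countable_image Subtype.val_injective.injOn
      (hX (Subtype.val '' D) K (hD.image IsInducing.subtypeVal) hK
        ((Subtype.coe_image_subset A D).trans hAK)))
  refine (exists_uncountable_discrete 𝒰 ?_ ?_ ?_ ?_).imp fun D h => ⟨h.1, h.2.1⟩
  · rintro _ ⟨N, _, hN, rfl⟩
    exact hN.isOpen_compl.preimage continuous_subtype_val
  · refine eq_univ_of_forall fun a => ?_
    obtain ⟨N, hN, hNc, hNa⟩ := exists_mem_nhds_isClosed_subset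
      (isOpen_compl_singleton.mem_nhds fun h : p = a.1 => hpA (h ▸ a.2))
    exact ⟨_, ⟨N, hN, hNc, rfl⟩, fun h => hNa h rfl⟩
  · intro 𝒱 h𝒱 h𝒱c hcov
    rcases 𝒱.eq_empty_or_nonempty with rfl | hne
    · obtain ⟨a, ha⟩ := closure_nonempty_iff.1 ⟨p, hp⟩
      have : (⟨a, ha⟩ : A) ∈ ⋃₀ (∅ : Set (Set A)) := hcov ▸ mem_univ _
      simp at this
    obtain ⟨V, rfl⟩ := h𝒱c.exists_eq_range hne
    have hV : ∀ n, ∃ N ∈ 𝓝 p, IsClosed N ∧ V n = Subtype.val ⁻¹' Nᶜ := fun n =>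
      h𝒱 (mem_range_self n)
    choose N hN hNc hVN using hV
    have hx : ∀ n : ℕ, ∃ x ∈ A, ∀ i ≤ n, x ∈ N i := by
      intro n
      have hmem : (⋂ i ∈ Iic n, N i) ∈ 𝓝 p :=
        (Filter.biInter_mem (finite_Iic n)).2 fun i _ => hN i
      obtain ⟨x, hx, hxA⟩ := mem_closure_iff_nhds.1 hp _ hmem
      exact ⟨x, hxA, fun i hi => mem_iInter₂.1 hx i hi⟩
    choose x hxA hxN using hx
    have hr : range x ⊆ A := range_subset_iff.2 hxA
    have hcl := hA _ hr (countable_range x)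
    obtain ⟨q, hq, hcluster⟩ := (hBcomp _ hr (countable_range x)).exists_mapClusterPt
      (u := x) (f := Filter.atTop) (by
        simpa using ⟨0, fun n _ => subset_closure (mem_range_self n)⟩)
    have hqN : ∀ n, q ∈ N n := fun n =>
      (hNc n).mem_of_mapClusterPt hcluster
        (Filter.eventually_atTop.2 ⟨n, fun m hm => hxN m n hm⟩)
    have : (⟨q, hcl hq⟩ : A) ∈ ⋃₀ range V := hcov ▸ mem_univ _
    obtain ⟨_, ⟨n, rfl⟩, hn⟩ := this
    rw [hVN n] at hn
    exact hn (hqN n)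
  · intro E hEc _
    have hr : Subtype.val '' E ⊆ A := Subtype.coe_image_subset A E
    have hcl := hA _ hr (hEc.image _)
    obtain ⟨N, hN, hNc, hNE⟩ := exists_mem_nhds_isClosed_subset
      ((isClosed_closure (s := Subtype.val '' E)).isOpen_compl.mem_nhds fun h => hpA (hcl h))
    refine ⟨{Subtype.val ⁻¹' Nᶜ}, singleton_subset_iff.2 ⟨N, hN, hNc, rfl⟩,
      countable_singleton _, ?_⟩
    rw [sUnion_singleton]
    intro y hy hyN
    exact hNE hyN (closure_subtype.1 hy)

/-! ### The Lindelöf property and the condensation -/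

/-- A discretely σ-compact space with countably tight compact subsets is Lindelöf. -/
theorem DiscretelySigmaCompact.lindelofSpace {Y : Type*} [TopologicalSpace Y]
    (hY : DiscretelySigmaCompact Y) (htight : CompactlyCountablyTight Y) [T2Space Y] :
    LindelofSpace Y := by
  refine ⟨isLindelof_of_countable_subcover fun {ι} U hU hcov => ?_⟩
  by_contra! hcon
  obtain ⟨D, hD, hDc, hfree⟩ := exists_uncountable_discrete (range U)
    (forall_mem_range.2 hU) (by rw [sUnion_range]; exact univ_subset_iff.1 hcov) (by
      intro 𝒱 h𝒱 h𝒱c heq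
      obtain ⟨t, -, ht, rfl⟩ := exists_countable_image_eq (image_univ (f := U) ▸ h𝒱) h𝒱c
      rw [sUnion_image] at heq
      exact hcon t ht heq.ge) (by
      intro E _ hE
      obtain ⟨t, ht, htc⟩ := (hY E hE).isLindelof.elim_countable_subcover U hU
        ((subset_univ _).trans hcov)
      exact ⟨U '' t, image_subset_range _ _, ht.image U, by rwa [sUnion_image]⟩)
  obtain ⟨K, hK, hKD⟩ := hY D hD
  let S : Set Y := {y | ∃ B ⊆ D, B.Countable ∧ y ∈ closure B}
  have hSD : S ⊆ closure D := fun y ⟨B, hB, _, hy⟩ => closure_mono hB hy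
  have hDS : D ⊆ S := fun y hy =>
    ⟨{y}, singleton_subset_iff.2 hy, countable_singleton y, subset_closure rfl⟩
  have hS : IsOmegaClosed S := by
    intro C hC hCc y hy
    have hC' : ∀ c ∈ C, ∃ B ⊆ D, B.Countable ∧ c ∈ closure B := hC
    choose! B hBD hBc hB using hC'
    refine ⟨⋃ c ∈ C, B c, iUnion₂_subset fun c hc => hBD c hc,
      hCc.biUnion fun c hc => hBc c hc, ?_⟩
    refine closure_minimal (fun c hc => ?_) isClosed_closure hy
    exact closure_mono (subset_biUnion_of_mem hc) (hB c hc)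
  have hSL : IsLindelof S := by
    have : S = ⋃ n, S ∩ K n := by
      rw [← inter_iUnion, hKD, inter_eq_left.2 hSD]
    rw [this]
    refine isLindelof_iUnion fun n => IsCompact.isLindelof ?_
    exact (hK n).of_isClosed_subset (htight _ _ (hK n) inter_subset_right
      (hS.inter (hK n).isClosed)) inter_subset_right
  choose W hWo hW hWD using hfree
  obtain ⟨r, hr, hcovr⟩ := hSL.elim_countable_subcover
    (fun B : {B : Set Y // B ⊆ D ∧ B.Countable} => W B.1 B.2.1 B.2.2)
    (fun B => hWo _ _ _) (fun y ⟨B, hB, hBc, hy⟩ => mem_iUnion.2 ⟨⟨B, hB, hBc⟩, hW _ _ _ hy⟩)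
  refine hDc ((hr.biUnion fun B _ => hWD B.1 B.2.1 B.2.2).mono fun y hy => ?_)
  obtain ⟨B, hB, hyB⟩ := mem_iUnion₂.1 (hcovr (hDS hy))
  exact mem_iUnion₂.2 ⟨B, hB, hyB, hy⟩

/-- Closures of subsets of the compact set `e '' K` stay inside it, so `e` need not have closed
range. -/
theorem CompactlyCountablyTight.of_isEmbedding {X Y : Type*} [TopologicalSpace X]
    [TopologicalSpace Y] [T2Space X] (hX : CompactlyCountablyTight X) {e : Y → X}
    (he : IsEmbedding e) : CompactlyCountablyTight Y := by
  intro A K hK hAK hA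
  have hKe := hK.image he.continuous
  have hcl : IsClosed (e '' A) := by
    refine hX _ _ hKe (image_mono hAK) fun B hB hBc => ?_
    obtain ⟨B, hBA, hBc', rfl⟩ := exists_countable_image_eq hB hBc
    intro x hx
    obtain ⟨y, -, rfl⟩ := closure_minimal (image_mono (hBA.trans hAK)) hKe.isClosed hx
    refine mem_image_of_mem e (hA B hBA hBc' ?_)
    rwa [he.closure_eq_preimage_closure_image]
  rw [← preimage_image_eq A he.injective]
  exact hcl.preimage he.continuous

/-- A Tychonoff space with discretely σ-compact co-diagonal condenses onto a separable metrizable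
space. -/
theorem DiscretelySigmaCompact.exists_continuous_injective {X : Type*} [TopologicalSpace X]
    [T35Space X] (hX : DiscretelySigmaCompact (coDiagonal X)) :
    ∃ f : X → ℕ → ℝ, Continuous f ∧ Function.Injective f := by
  have htight := compactlyCountablyTight_of_countable_of_isDiscrete
    fun E K hE hK hEK => hX.countable_of_isDiscrete hE hK hEK
  have := hX.lindelofSpace (htight.prod.of_isEmbedding IsEmbedding.subtypeVal)
  obtain ⟨f, hf, hsep⟩ := (isLindelof_univ.image
    (continuous_subtype_val (p := (· ∈ coDiagonal X)))).exists_continuous_separating (by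
      rintro _ ⟨z, _, rfl⟩
      exact z.2)
  refine ⟨f, hf, fun x y hxy => ?_⟩
  by_contra hne
  exact hsep (x, y) ⟨⟨(x, y), hne⟩, mem_univ _, rfl⟩ hxy

/-! ### Pseudocompact spaces -/

/-- A continuous injection of a pseudocompact Tychonoff space into a metric space is an
embedding. -/
theorem IsPseudocompact.isEmbedding {X M : Type*} [TopologicalSpace X] [T35Space X]
    [MetricSpace M] (hX : IsPseudocompact X) {f : X → M} (hf : Continuous f)
    (hinj : Function.Injective f) : IsEmbedding f := by
  refine ⟨isInducing_iff_nhds.2 fun x => le_antisymm hf.continuousAt.le_comap fun U hU => ?_,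
    hinj⟩
  obtain ⟨g, hg, hg0, hg1⟩ := CompletelyRegularSpace.completely_regular x (interior U)ᶜ
    isOpen_interior.isClosed_compl (not_not.2 (mem_interior_iff_mem_nhds.2 hU))
  -- The numerator vanishes near `x`, so `h` is continuous there despite the zero denominator. Off
  -- `U` it is 1/2, so a bound on `h` keeps `f y` away from `f x`.
  let h : X → ℝ := fun y => max 0 ((g y : ℝ) - 1 / 2) / dist (f y) (f x)
  have hgc : Continuous fun y => (g y : ℝ) := continuous_subtype_val.comp hg
  have hh : Continuous h := by
    refine continuous_iff_continuousAt.2 fun y => ?_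
    by_cases hyx : y = x
    · have h0 : ∀ᶠ z in 𝓝 y, h z = 0 := by
        have : ∀ᶠ z in 𝓝 y, (g z : ℝ) < 1 / 2 :=
          hgc.continuousAt.eventually_lt continuousAt_const (by rw [hyx, hg0]; norm_num)
        filter_upwards [this] with z hz
        simp only [h]
        rw [max_eq_left (by linarith), zero_div]
      exact (continuousAt_congr h0).2 continuousAt_const
    · refine ContinuousAt.div (by fun_prop) (by fun_prop) ?_
      exact dist_ne_zero.2 (hinj.ne hyx)
  obtain ⟨C, hC⟩ := (hX h hh).exists_norm_le
  have hC0 : 0 ≤ C := (norm_nonneg _).trans (hC _ (mem_range_self x))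
  refine ⟨Metric.ball (f x) (1 / (2 * (C + 1))), Metric.ball_mem_nhds _ (by positivity), ?_⟩
  intro y hy
  by_contra hyU
  have hy1 : g y = 1 := hg1 fun h => hyU (interior_subset h)
  have hyx : y ≠ x := fun h => hyU (h ▸ mem_of_mem_nhds hU)
  have hd : 0 < dist (f y) (f x) := dist_pos.2 (hinj.ne hyx)
  have hle : h y ≤ C := (le_abs_self _).trans (hC _ (mem_range_self y))
  have hval : h y = (1 / 2) / dist (f y) (f x) := by
    simp only [h, hy1, Icc.coe_one]
    norm_num
  rw [hval, div_le_iff₀ hd] at hle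
  have hlt : dist (f y) (f x) < 1 / (2 * (C + 1)) := hy
  rw [lt_div_iff₀ (by positivity)] at hlt
  nlinarith

/-- A continuous image of a pseudocompact space in a metric space is closed. -/
theorem IsPseudocompact.isClosed_range {X M : Type*} [TopologicalSpace X] [MetricSpace M]
    (hX : IsPseudocompact X) {f : X → M} (hf : Continuous f) : IsClosed (range f) := by
  refine isClosed_of_closure_subset fun p hp => ?_
  by_contra hnot
  have hpos : ∀ y, 0 < dist (f y) p := fun y => dist_pos.2 fun h => hnot ⟨y, h⟩
  obtain ⟨C, hC⟩ := (hX (fun y => (dist (f y) p)⁻¹)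
    ((by fun_prop : Continuous fun y => dist (f y) p).inv₀ fun y => (hpos y).ne')).exists_norm_le
  obtain ⟨_, ⟨x, rfl⟩, -⟩ := Metric.mem_closure_iff.1 hp 1 one_pos
  have hC0 : 0 ≤ C := (norm_nonneg _).trans (hC _ (mem_range_self x))
  obtain ⟨_, ⟨y, rfl⟩, hy⟩ := Metric.mem_closure_iff.1 hp (1 / (C + 1)) (by positivity)
  have hle := (le_abs_self _).trans (hC _ (mem_range_self y))
  rw [inv_le_iff_one_le_mul₀ (hpos y)] at hle
  rw [dist_comm, lt_div_iff₀ (by positivity)] at hy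
  nlinarith [hpos y]

/-- A pseudocompact Tychonoff space that condenses onto a separable metrizable space is compact
and metrizable. -/
theorem IsPseudocompact.compactSpace_and_metrizableSpace {X : Type*} [TopologicalSpace X]
    [T35Space X] (hX : IsPseudocompact X) {f : X → ℕ → ℝ} (hf : Continuous f)
    (hinj : Function.Injective f) :
    CompactSpace X ∧ TopologicalSpace.MetrizableSpace X := by
  let _ : MetricSpace (ℕ → ℝ) := TopologicalSpace.metrizableSpaceMetric _
  have hemb := hX.isEmbedding hf hinj
  refine ⟨⟨?_⟩, hemb.metrizableSpace⟩
  have hbdd : ∀ n, ∃ C, ∀ x, |f x n| ≤ C := fun n => by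
    obtain ⟨C, hC⟩ := (hX (fun x => f x n) ((continuous_apply n).comp hf)).exists_norm_le
    exact ⟨C, fun x => hC _ (mem_range_self x)⟩
  choose C hC using hbdd
  rw [hemb.isCompact_iff, image_univ]
  refine (isCompact_univ_pi fun n => isCompact_Icc (a := -C n) (b := C n)).of_isClosed_subset
    (hX.isClosed_range hf) ?_
  rintro _ ⟨x, rfl⟩ n -
  exact abs_le.1 (hC n x)

/-! ### Lindelöf Σ-spaces -/

/-- A Lindelöf Σ-space that condenses onto a second countable Hausdorff space is cosmic. -/
theorem IsLindelofSigma.isCosmic {X M : Type*} [TopologicalSpace X] [TopologicalSpace M]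
    [T2Space M] [SecondCountableTopology M] (hX : IsLindelofSigma X) {f : X → M}
    (hf : Continuous f) (hinj : Function.Injective f) : IsCosmic X := by
  obtain ⟨F, C, hF, hC, hCX, hFC⟩ := hX
  let N : Set (Set X) :=
    image2 (fun A B => A ∩ f ⁻¹' B) F (TopologicalSpace.countableBasis M)
  refine ⟨N, hF.image2 (TopologicalSpace.countable_countableBasis M) _, fun U hU =>
    ⟨{A ∈ N | A ⊆ U}, sep_subset _ _, Subset.antisymm (fun x hx => ?_)
      (sUnion_subset fun A hA => hA.2)⟩⟩
  obtain ⟨K, hKC, hxK⟩ : x ∈ ⋃₀ C := hCX ▸ mem_univ x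
  have hdisj : Disjoint {f x} (f '' (K \ U)) := by
    rw [disjoint_singleton_left]
    rintro ⟨y, hy, hyx⟩
    exact hy.2 (hinj hyx ▸ hx)
  obtain ⟨V, V', hV, hV', hxV, hKV', hVV'⟩ := SeparatedNhds.of_isCompact_isCompact
    isCompact_singleton (((hC K hKC).diff hU).image hf) hdisj
  obtain ⟨B, hB, hxB, hBV⟩ := (TopologicalSpace.isBasis_countableBasis M).exists_subset_of_mem_open
    (hxV rfl) hV
  -- `K` need not lie in `U`; the excess `K \ U` is absorbed by `f ⁻¹' V'`, which intersecting with
  -- `f ⁻¹' B` then removes.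
  obtain ⟨A, hA, hKA, hAU⟩ := hFC K hKC (U ∪ f ⁻¹' V') (hU.union (hV'.preimage hf)) (by
    intro y hy
    by_cases hyU : y ∈ U
    · exact Or.inl hyU
    · exact Or.inr (hKV' (mem_image_of_mem f ⟨hy, hyU⟩)))
  refine ⟨A ∩ f ⁻¹' B, ⟨⟨A, hA, B, hB, rfl⟩, ?_⟩, hKA hxK, hxB⟩
  rintro y ⟨hyA, hyB⟩
  exact (hAU hyA).resolve_right fun h => disjoint_left.1 hVV' (hBV hyB) h

theorem corollary3p2 (X : Type*) [TopologicalSpace X] [T35Space X]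
    (hX : DiscretelySigmaCompact (coDiagonal X)) :
    (IsPseudocompact X → CompactSpace X ∧ TopologicalSpace.MetrizableSpace X) ∧
      (IsLindelofSigma X → IsCosmic X) := by
  obtain ⟨f, hf, hinj⟩ := hX.exists_continuous_injective
  exact ⟨fun h => h.compactSpace_and_metrizableSpace hf hinj, fun h => h.isCosmic hf hinj⟩
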